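/- Let $\mathbb{H}$ be the quaternions, $\mathbb{B}=\{q\in\mathbb{H} : |q|<1\}$ and $\mathbb{S}=\{I\in\mathbb{H} : I^2=-1\}$. A function $f:\mathbb{B}\to\mathbb{H}$ is called slice regular if, for every $I\in\mathbb{S}$, the restriction $f_I$ of $f$ to $\mathbb{B}\cap(\mathbb{R}+I\mathbb{R})$ is (real) differentiable and satisfies $$\frac12\left(\frac{\partial}{\partial x}+I\frac{\partial}{\partial y}\right)f_I(x+Iy)=0$$ at all points $x+Iy\in\mathbb{B}$ with $x,y\in\mathbb{R}$. Theorem. Let $f:\mathbb{B}\to\mathbb{B}$ be a slice regular function and suppose that $f$ has a fixed point $q_0\in\mathbb{B}$. Then either $f$ is the identity function of $\mathbb{B}$, or $f$ has no other fixed point in $\mathbb{B}$. -/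

import Mathlib

noncomputable section

namespace SliceRegular

/-- The `2`-sphere `𝕊 = {q ∈ ℍ | q² = -1}` of imaginary units. -/
def imaginaryUnits : Set (Quaternion ℝ) := {q | q ^ 2 = -1}

/-- The open unit ball `𝔹 = {q ∈ ℍ | ‖q‖ < 1}` of the quaternions. -/
def unitBall : Set (Quaternion ℝ) := {q | ‖q‖ < 1}

/-- The parametrization `x + i y ↦ x + I y` of the slice `L_I = ℝ + I ℝ` by the plane `ℂ`. -/
def sliceMap (I : Quaternion ℝ) (z : ℂ) : Quaternion ℝ :=
  (z.re : Quaternion ℝ) + I * (z.im : Quaternion ℝ)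

/-- `∂̄_I f (x + I y) = (1/2) (∂/∂x + I ∂/∂y) f_I (x + I y)`, with `z = x + i y`: the partial
derivatives are the values of the real differential of `f_I` at the vectors `1` and `i`. -/
def dbar (I : Quaternion ℝ) (f : Quaternion ℝ → Quaternion ℝ) (z : ℂ) : Quaternion ℝ :=
  (1 / 2 : ℝ) • (fderiv ℝ (fun w : ℂ => f (sliceMap I w)) z 1
    + I * fderiv ℝ (fun w : ℂ => f (sliceMap I w)) z Complex.I)

/-- Slice regularity of `f` on an open set `Ω ⊆ ℍ`: for every imaginary unit `I`, the restriction
of `f` to `Ω ∩ L_I` is real differentiable and `∂̄_I f` vanishes identically there. Only the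
values of `f` on `Ω` matter. -/
def IsSliceRegularOn (f : Quaternion ℝ → Quaternion ℝ) (Ω : Set (Quaternion ℝ)) : Prop :=
  ∀ I ∈ imaginaryUnits, ∀ z : ℂ, sliceMap I z ∈ Ω →
    DifferentiableAt ℝ (fun w : ℂ => f (sliceMap I w)) z ∧ dbar I f z = 0

end SliceRegular

end

/-!
A slice regular function is the sum of a power series `f q = ∑ qⁿ aₙ`, that is, of an `A : ℍ⟦X⟧`,
and the product of `ℍ⟦X⟧` is the regular product of slice regular functions. If `‖f‖ ≤ 1`, then
multiplication by `A` is a contraction of the Hardy space of power series with square summable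
coefficients: on each circle the Fourier series `P + iQ` of `A` satisfies `‖P + IQ‖ ≤ 1` for all
imaginary units `I`, hence is pointwise a contraction, and Parseval's identity applies.

Let `p ≠ q` be fixed points of `f` and `H` the difference of the reproducing kernels at `p` and
`q`. Its constant coefficient vanishes, so `H = X * U` with `‖U‖ = ‖H‖`. The value of `A * U` at `p`
depends only on `f p` and `U`, so `A * U` and `X * U` agree at `p` and at `q`, and therefore
`⟪H, A * U⟫ = ⟪H, X * U⟫ = ‖H‖²`. As `‖A * U‖ ≤ ‖H‖`, the equality case of the Cauchy–Schwarz
inequality gives `A * U = X * U`, and `U` can be cancelled because `ℍ⟦X⟧` has no zero divisors.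
-/

open scoped Quaternion PowerSeries Topology
open Filter Finset PowerSeries

namespace SliceRegular

section ImaginaryUnits

theorem mem_imaginaryUnits_iff {I : ℍ} : I ∈ imaginaryUnits ↔ I.re = 0 ∧ ‖I‖ = 1 := by
  rw [← Quaternion.sq_eq_neg_normSq, Quaternion.normSq_eq_norm_mul_self]
  constructor
  · intro (hI : I ^ 2 = -1)
    have hnorm : ‖I‖ = 1 := by
      rw [← pow_eq_one_iff_of_nonneg (norm_nonneg I) two_ne_zero, ← norm_pow, hI, norm_neg,
        norm_one]
    simp [hI, hnorm]
  · rintro ⟨hI, hnorm⟩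
    exact hI.trans (by simp [hnorm])

theorem coeComplex_I_mem_imaginaryUnits : ((Complex.I : ℂ) : ℍ) ∈ imaginaryUnits := by
  change ((Complex.I : ℂ) : ℍ) ^ 2 = -1
  rw [sq, ← Quaternion.coeComplex_mul, Complex.I_mul_I]
  ext <;> simp

theorem exists_mem_imaginaryUnits_norm_smul_eq {w : ℍ} (hw : w.re = 0) :
    ∃ I ∈ imaginaryUnits, ‖w‖ • I = w := by
  rcases eq_or_ne w 0 with rfl | hw0
  · exact ⟨_, coeComplex_I_mem_imaginaryUnits, by simp⟩
  · have hnorm : ‖w‖ ≠ 0 := norm_ne_zero_iff.2 hw0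
    refine ⟨‖w‖⁻¹ • w, mem_imaginaryUnits_iff.2 ⟨by simp [hw], ?_⟩, smul_inv_smul₀ hnorm w⟩
    rw [norm_smul, norm_inv, norm_norm, inv_mul_cancel₀ hnorm]

theorem exists_sliceMap_eq (q : ℍ) : ∃ I ∈ imaginaryUnits, ∃ z : ℂ, sliceMap I z = q := by
  obtain ⟨I, hI, h⟩ := exists_mem_imaginaryUnits_norm_smul_eq (w := q.im) (by simp)
  refine ⟨I, hI, ⟨q.re, ‖q.im‖⟩, ?_⟩
  rw [sliceMap, Quaternion.mul_coe_eq_smul, h, Quaternion.re_add_im]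

theorem norm_sliceMap {I : ℍ} (hI : I ∈ imaginaryUnits) (z : ℂ) : ‖sliceMap I z‖ = ‖z‖ := by
  obtain ⟨hre, hnorm⟩ := mem_imaginaryUnits_iff.1 hI
  have horth : inner ℝ (z.re : ℍ) (I * (z.im : ℍ)) = 0 := by
    simp [Quaternion.inner_def, hre]
  rw [← sq_eq_sq₀ (norm_nonneg _) (norm_nonneg _), sliceMap, norm_add_sq_real, horth, norm_mul,
    hnorm, Complex.sq_norm, Complex.normSq_apply]
  simp [sq]

theorem sliceMap_mem_unitBall {I : ℍ} (hI : I ∈ imaginaryUnits) {z : ℂ} :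
    sliceMap I z ∈ unitBall ↔ ‖z‖ < 1 := by
  rw [unitBall, Set.mem_ofPred_eq, norm_sliceMap hI]

theorem sliceMap_ofReal (I : ℍ) (x : ℝ) : sliceMap I x = x := by
  simp [sliceMap]

/-- The parametrization of the slice `ℝ + Iℝ` as a homomorphism of real algebras. -/
def sliceHom {I : ℍ} (hI : I ∈ imaginaryUnits) : ℂ →ₐ[ℝ] ℍ :=
  Complex.liftAux I (by rw [← sq]; exact hI)

theorem sliceHom_apply {I : ℍ} (hI : I ∈ imaginaryUnits) (z : ℂ) :
    sliceHom hI z = sliceMap I z := by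
  rw [sliceHom, Complex.liftAux_apply, sliceMap, Quaternion.mul_coe_eq_smul]
  rfl

theorem sliceMap_pow {I : ℍ} (hI : I ∈ imaginaryUnits) (z : ℂ) (n : ℕ) :
    sliceMap I (z ^ n) = sliceMap I z ^ n := by
  simp only [← sliceHom_apply hI, map_pow]

/-- The complex normed space structure on `ℍ` in which `i` acts as left multiplication by `I`;
for it, slice regularity on `ℝ + Iℝ` is complex differentiability. -/
@[reducible] noncomputable def sliceNormedSpace {I : ℍ} (hI : I ∈ imaginaryUnits) :
    NormedSpace ℂ ℍ :=
  { Module.compHom ℍ (sliceHom hI).toRingHom with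
    norm_smul_le := fun z q => by
      change ‖sliceHom hI z * q‖ ≤ ‖z‖ * ‖q‖
      rw [norm_mul, sliceHom_apply, norm_sliceMap hI] }

theorem sliceNormedSpace_smul_eq {I : ℍ} (hI : I ∈ imaginaryUnits) (z : ℂ) (q : ℍ) :
    letI := sliceNormedSpace hI
    z • q = sliceMap I z * q := by
  rw [← sliceHom_apply hI]
  rfl

end ImaginaryUnits

section Expansion

/-- `f` is the sum on the unit ball of the power series `A` with coefficients on the right. The
indeterminate of `ℍ⟦X⟧` commutes with the coefficients, so that the product of `ℍ⟦X⟧` is the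
regular product of slice regular functions. -/
def HasExpansion (f : ℍ → ℍ) (A : ℍ⟦X⟧) : Prop :=
  ∀ q ∈ unitBall, HasSum (fun n => q ^ n * coeff n A) (f q)

theorem hasExpansion_X : HasExpansion id X := fun q _ => by
  simpa [coeff_X] using
    hasSum_single (f := fun n => q ^ n * coeff n (X : ℍ⟦X⟧)) 1 fun n hn => by simp [coeff_X, hn]

theorem IsSliceRegularOn.fderiv_slice_apply {f : ℍ → ℍ} {Ω : Set ℍ} (hf : IsSliceRegularOn f Ω)
    {I : ℍ} (hI : I ∈ imaginaryUnits) {z : ℂ} (hz : sliceMap I z ∈ Ω) (w : ℂ) :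
    fderiv ℝ (fun w => f (sliceMap I w)) z w =
      sliceMap I w * fderiv ℝ (fun w => f (sliceMap I w)) z 1 := by
  have hdbar := (hf I hI z hz).2
  rw [dbar] at hdbar
  set D := fderiv ℝ (fun w => f (sliceMap I w)) z
  have hCR : D Complex.I = I * D 1 := by
    have hII : I * I = -1 := (sq I).symm.trans hI
    have h1 : D 1 = -(I * D Complex.I) :=
      eq_neg_of_add_eq_zero_left ((smul_eq_zero.1 hdbar).resolve_left (by norm_num))
    rw [h1, mul_neg, ← mul_assoc, hII, neg_one_mul, neg_neg]
  calc D w = D (w.re • 1 + w.im • Complex.I) := by congr 1; apply Complex.ext <;> simp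
    _ = sliceMap I w * D 1 := by
      rw [map_add, map_smul, map_smul, hCR, sliceMap, add_mul, Quaternion.coe_mul_eq_smul,
        Quaternion.mul_coe_eq_smul, smul_mul_assoc]

theorem IsSliceRegularOn.differentiableAt_slice {f : ℍ → ℍ} {Ω : Set ℍ}
    (hf : IsSliceRegularOn f Ω) {I : ℍ} (hI : I ∈ imaginaryUnits) {z : ℂ}
    (hz : sliceMap I z ∈ Ω) :
    letI := sliceNormedSpace hI
    DifferentiableAt ℂ (fun w => f (sliceMap I w)) z := by
  let _ := sliceNormedSpace hI
  have : IsScalarTower ℝ ℂ ℍ := ⟨fun r z q => by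
    simp only [sliceNormedSpace_smul_eq hI, ← sliceHom_apply hI, map_smul, smul_mul_assoc]⟩
  set D := fderiv ℝ (fun w => f (sliceMap I w)) z with hD
  have hderiv : HasFDerivAt (𝕜 := ℂ) (fun w => f (sliceMap I w))
      (ContinuousLinearMap.toSpanSingleton ℂ (D 1)) z := by
    refine hasFDerivAt_of_restrictScalars ℝ (hf I hI z hz).1.hasFDerivAt ?_
    refine ContinuousLinearMap.ext fun w => ?_
    change w • D 1 = D w
    rw [sliceNormedSpace_smul_eq hI, hD, hf.fderiv_slice_apply hI hz w]
  exact hderiv.differentiableAt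

theorem IsSliceRegularOn.exists_hasSum_slice {f : ℍ → ℍ} (hf : IsSliceRegularOn f unitBall)
    {I : ℍ} (hI : I ∈ imaginaryUnits) :
    ∃ a : ℕ → ℍ, ∀ z : ℂ, ‖z‖ < 1 →
      HasSum (fun n => sliceMap I z ^ n * a n) (f (sliceMap I z)) := by
  let _ := sliceNormedSpace hI
  set g : ℂ → ℍ := fun w => f (sliceMap I w)
  have hg : DifferentiableOn ℂ g (Metric.ball 0 1) := fun z hz =>
    (hf.differentiableAt_slice hI
      ((sliceMap_mem_unitBall hI).2 (mem_ball_zero_iff.1 hz))).differentiableWithinAt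
  refine ⟨fun n => (n.factorial : ℂ)⁻¹ • iteratedDeriv n g 0, fun z hz => ?_⟩
  refine (Complex.hasSum_taylorSeries_on_ball hg (mem_ball_zero_iff.2 hz)).congr_fun fun n => ?_
  rw [smul_comm, sub_zero, ← sliceMap_pow hI, ← sliceNormedSpace_smul_eq hI]

theorem eq_of_hasSum_pow_smul {E : Type*} [NormedAddCommGroup E] [NormedSpace ℝ E]
    {a b : ℕ → E} {g : ℝ → E} (ha : ∀ x : ℝ, |x| < 1 → HasSum (fun n => x ^ n • a n) (g x))
    (hb : ∀ x : ℝ, |x| < 1 → HasSum (fun n => x ^ n • b n) (g x)) : a = b := by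
  have hasFPowerSeriesAt {c : ℕ → E}
      (hc : ∀ x : ℝ, |x| < 1 → HasSum (fun n => x ^ n • c n) (g x)) :
      HasFPowerSeriesAt g (fun n => ContinuousMultilinearMap.mkPiRing ℝ (Fin n) (c n)) 0 := by
    refine hasFPowerSeriesAt_iff.2 ?_
    filter_upwards [Metric.ball_mem_nhds (0 : ℝ) one_pos] with x hx
    simpa [FormalMultilinearSeries.coeff] using hc x (by simpa using hx)
  have h := (hasFPowerSeriesAt ha).eq_formalMultilinearSeries (hasFPowerSeriesAt hb)
  funext n
  simpa [FormalMultilinearSeries.coeff] using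
    congrArg (fun p => FormalMultilinearSeries.coeff p n) h

theorem IsSliceRegularOn.exists_hasExpansion {f : ℍ → ℍ} (hf : IsSliceRegularOn f unitBall) :
    ∃ A : ℍ⟦X⟧, HasExpansion f A := by
  choose! a ha using fun I (hI : I ∈ imaginaryUnits) => hf.exists_hasSum_slice hI
  have hreal : ∀ I ∈ imaginaryUnits, ∀ x : ℝ, |x| < 1 →
      HasSum (fun n => x ^ n • a I n) (f x) := by
    intro I hI x hx
    have h := ha I hI x (by simpa using hx)
    simpa only [sliceMap_ofReal, ← Quaternion.coe_pow, Quaternion.coe_mul_eq_smul] using h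
  refine ⟨PowerSeries.mk (a (Complex.I : ℂ)), fun q hq => ?_⟩
  obtain ⟨I, hI, z, rfl⟩ := exists_sliceMap_eq q
  simp only [coeff_mk, eq_of_hasSum_pow_smul (hreal _ coeComplex_I_mem_imaginaryUnits) (hreal I hI)]
  exact ha I hI z ((sliceMap_mem_unitBall hI).1 hq)

end Expansion

section TrigonometricSeries

theorem summable_sq_norm {E : Type*} [SeminormedAddCommGroup E] {c : ℕ → E}
    (hc : Summable fun n => ‖c n‖) : Summable fun n => ‖c n‖ ^ 2 := by
  refine hc.of_norm_bounded_eventually_nat ?_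
  filter_upwards [hc.tendsto_atTop_zero.eventually_le_const one_pos] with n hn
  rw [norm_pow, norm_norm, sq]
  exact mul_le_of_le_one_left (norm_nonneg _) hn

section NormedSpace

variable {E : Type*} [NormedAddCommGroup E] [NormedSpace ℝ E]

/-- The real part `∑ cos (n θ) c n` of the Fourier series `∑ exp (i n θ) c n`, which has its values
in the complexification of `E`. -/
noncomputable def cosSeries (c : ℕ → E) (θ : ℝ) : E := ∑' n : ℕ, Real.cos (n * θ) • c n

/-- The imaginary part `∑ sin (n θ) c n` of the Fourier series `∑ exp (i n θ) c n`, which has its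
values in the complexification of `E`. -/
noncomputable def sinSeries (c : ℕ → E) (θ : ℝ) : E := ∑' n : ℕ, Real.sin (n * θ) • c n

theorem norm_cos_smul_le (x : ℝ) (v : E) : ‖Real.cos x • v‖ ≤ ‖v‖ := by
  rw [norm_smul]
  exact mul_le_of_le_one_left (norm_nonneg _) (Real.abs_cos_le_one x)

theorem norm_sin_smul_le (x : ℝ) (v : E) : ‖Real.sin x • v‖ ≤ ‖v‖ := by
  rw [norm_smul]
  exact mul_le_of_le_one_left (norm_nonneg _) (Real.abs_sin_le_one x)

variable {c : ℕ → E}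

theorem summable_norm_cos_smul (hc : Summable fun n => ‖c n‖) (θ : ℝ) :
    Summable fun n : ℕ => ‖Real.cos (n * θ) • c n‖ :=
  hc.of_nonneg_of_le (fun _ => norm_nonneg _) fun _ => norm_cos_smul_le _ _

theorem summable_norm_sin_smul (hc : Summable fun n => ‖c n‖) (θ : ℝ) :
    Summable fun n : ℕ => ‖Real.sin (n * θ) • c n‖ :=
  hc.of_nonneg_of_le (fun _ => norm_nonneg _) fun _ => norm_sin_smul_le _ _

variable [CompleteSpace E]

theorem hasSum_cosSeries (hc : Summable fun n => ‖c n‖) (θ : ℝ) :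
    HasSum (fun n : ℕ => Real.cos (n * θ) • c n) (cosSeries c θ) :=
  (summable_norm_cos_smul hc θ).of_norm.hasSum

theorem hasSum_sinSeries (hc : Summable fun n => ‖c n‖) (θ : ℝ) :
    HasSum (fun n : ℕ => Real.sin (n * θ) • c n) (sinSeries c θ) :=
  (summable_norm_sin_smul hc θ).of_norm.hasSum

theorem continuous_cosSeries (hc : Summable fun n => ‖c n‖) : Continuous (cosSeries c) :=
  continuous_tsum (fun n => by fun_prop) hc fun _ _ => norm_cos_smul_le _ _

theorem continuous_sinSeries (hc : Summable fun n => ‖c n‖) : Continuous (sinSeries c) :=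
  continuous_tsum (fun n => by fun_prop) hc fun _ _ => norm_sin_smul_le _ _

theorem continuous_norm_sq_cosSeries_add_norm_sq_sinSeries (hc : Summable fun n => ‖c n‖) :
    Continuous fun θ => ‖cosSeries c θ‖ ^ 2 + ‖sinSeries c θ‖ ^ 2 :=
  ((continuous_cosSeries hc).norm.pow 2).add ((continuous_sinSeries hc).norm.pow 2)

end NormedSpace

section Parseval

variable {E : Type*} [NormedAddCommGroup E] [InnerProductSpace ℝ E]

theorem hasSum_inner_inner_of_summable_norm {ι κ : Type*} {x : ι → E} {y : κ → E} {s t : E}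
    (hx : Summable fun n => ‖x n‖) (hy : Summable fun n => ‖y n‖) (hs : HasSum x s)
    (ht : HasSum y t) : HasSum (fun p : ι × κ => inner ℝ (x p.1) (y p.2)) (inner ℝ s t) := by
  have hsum : Summable fun p : ι × κ => inner ℝ (x p.1) (y p.2) :=
    Summable.of_norm_bounded (hx.mul_of_nonneg hy (fun _ => norm_nonneg _) fun _ => norm_nonneg _)
      fun p => norm_inner_le_norm _ _
  have hrow (n : ι) : HasSum (fun m => inner ℝ (x n) (y m)) (inner ℝ (x n) t) :=
    (innerSL ℝ (x n)).hasSum ht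
  have hcol : HasSum (fun n => inner ℝ (x n) t) (inner ℝ s t) := by
    simpa [real_inner_comm] using (innerSL ℝ t).hasSum hs
  rw [← (hsum.hasSum.prod_fiberwise hrow).unique hcol]
  exact hsum.hasSum

variable [CompleteSpace E] {c : ℕ → E}

theorem hasSum_norm_sq_cosSeries_add_norm_sq_sinSeries
    (hc : Summable fun n => ‖c n‖) (θ : ℝ) :
    HasSum (fun p : ℕ × ℕ => Real.cos ((p.1 - p.2) * θ) * inner ℝ (c p.1) (c p.2))
      (‖cosSeries c θ‖ ^ 2 + ‖sinSeries c θ‖ ^ 2) := by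
  have hcos := summable_norm_cos_smul hc θ
  have hsin := summable_norm_sin_smul hc θ
  rw [← real_inner_self_eq_norm_sq, ← real_inner_self_eq_norm_sq]
  refine ((hasSum_inner_inner_of_summable_norm hcos hcos (hasSum_cosSeries hc θ)
    (hasSum_cosSeries hc θ)).add (hasSum_inner_inner_of_summable_norm hsin hsin
    (hasSum_sinSeries hc θ) (hasSum_sinSeries hc θ))).congr_fun fun p => ?_
  simp only [real_inner_smul_left, real_inner_smul_right]
  rw [sub_mul, Real.cos_sub]
  ring

theorem integral_cos_sub_mul (m n : ℕ) :
    ∫ θ in (0 : ℝ)..2 * Real.pi, Real.cos ((m - n) * θ) = if m = n then 2 * Real.pi else 0 := by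
  split_ifs with h
  · simp [h]
  · have hmn : (m : ℝ) - n ≠ 0 := sub_ne_zero.2 (Nat.cast_injective.ne h)
    have hsin : Real.sin ((m - n) * (2 * Real.pi)) = 0 := by
      simpa [mul_comm, mul_left_comm] using Real.sin_int_mul_pi (2 * (m - n))
    rw [intervalIntegral.integral_comp_mul_left _ hmn, integral_cos, hsin]
    simp

theorem integral_norm_sq_cosSeries_add_norm_sq_sinSeries (hc : Summable fun n => ‖c n‖) :
    ∫ θ in (0 : ℝ)..2 * Real.pi, (‖cosSeries c θ‖ ^ 2 + ‖sinSeries c θ‖ ^ 2) =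
      2 * Real.pi * ∑' n, ‖c n‖ ^ 2 := by
  have hsum : Summable fun p : ℕ × ℕ => ‖c p.1‖ * ‖c p.2‖ :=
    hc.mul_of_nonneg hc (fun _ => norm_nonneg _) fun _ => norm_nonneg _
  have hbound (p : ℕ × ℕ) (θ : ℝ) :
      ‖Real.cos ((p.1 - p.2) * θ) * inner ℝ (c p.1) (c p.2)‖ ≤ ‖c p.1‖ * ‖c p.2‖ := by
    rw [norm_mul]
    exact (mul_le_of_le_one_left (norm_nonneg _) (Real.abs_cos_le_one _)).trans
      (norm_inner_le_norm _ _)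
  have hint := intervalIntegral.hasSum_integral_of_dominated_convergence
    (μ := MeasureTheory.volume) (a := 0) (b := 2 * Real.pi)
    (F := fun (p : ℕ × ℕ) (θ : ℝ) => Real.cos ((p.1 - p.2) * θ) * inner ℝ (c p.1) (c p.2))
    (fun p _ => ‖c p.1‖ * ‖c p.2‖)
    (fun p => (by fun_prop : Continuous _).aestronglyMeasurable)
    (fun p => .of_forall fun θ _ => hbound p θ) (.of_forall fun _ _ => hsum) (by simp)
    (.of_forall fun θ _ => hasSum_norm_sq_cosSeries_add_norm_sq_sinSeries hc θ)
  simp only [intervalIntegral.integral_mul_const, integral_cos_sub_mul, ite_mul, zero_mul] at hint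
  have hdiag : HasSum (fun p : ℕ × ℕ =>
      if p.1 = p.2 then 2 * Real.pi * inner ℝ (c p.1) (c p.2) else 0)
      (2 * Real.pi * ∑' n, ‖c n‖ ^ 2) := by
    have hinj : Function.Injective fun n : ℕ => (n, n) := fun _ _ h => congrArg Prod.fst h
    refine (hinj.hasSum_iff fun p hp => if_neg fun h => hp ⟨p.1, Prod.ext rfl h⟩).1 ?_
    simpa [Function.comp_def] using (summable_sq_norm hc).hasSum.mul_left (2 * Real.pi)
  exact hint.unique hdiag

end Parseval

section CauchyProduct

variable {R : Type*} [NormedRing R]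

theorem summable_norm_coeff_mul {A B : R⟦X⟧} (hA : Summable fun n => ‖coeff n A‖)
    (hB : Summable fun n => ‖coeff n B‖) : Summable fun n => ‖coeff n (A * B)‖ := by
  simpa only [coeff_mul] using summable_norm_sum_mul_antidiagonal_of_summable_norm hA hB

variable [NormedAlgebra ℝ R] [CompleteSpace R]

theorem cosSeries_coeff_mul {A B : R⟦X⟧} (hA : Summable fun n => ‖coeff n A‖)
    (hB : Summable fun n => ‖coeff n B‖) (θ : ℝ) :
    cosSeries (fun n => coeff n (A * B)) θ =
      cosSeries (fun n => coeff n A) θ * cosSeries (fun n => coeff n B) θ -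
      sinSeries (fun n => coeff n A) θ * sinSeries (fun n => coeff n B) θ := by
  have hAc := summable_norm_cos_smul hA θ
  have hAs := summable_norm_sin_smul hA θ
  have hBc := summable_norm_cos_smul hB θ
  have hBs := summable_norm_sin_smul hB θ
  simp only [cosSeries, sinSeries]
  rw [tsum_mul_tsum_eq_tsum_sum_antidiagonal_of_summable_norm hAc hBc,
    tsum_mul_tsum_eq_tsum_sum_antidiagonal_of_summable_norm hAs hBs,
    ← (summable_norm_sum_mul_antidiagonal_of_summable_norm hAc hBc).of_norm.tsum_sub
      (summable_norm_sum_mul_antidiagonal_of_summable_norm hAs hBs).of_norm]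
  refine tsum_congr fun n => ?_
  rw [coeff_mul, smul_sum, ← sum_sub_distrib]
  refine sum_congr rfl fun p hp => ?_
  rw [← mem_antidiagonal.1 hp, Nat.cast_add, add_mul, Real.cos_add, smul_mul_smul_comm,
    smul_mul_smul_comm, sub_smul]

theorem sinSeries_coeff_mul {A B : R⟦X⟧} (hA : Summable fun n => ‖coeff n A‖)
    (hB : Summable fun n => ‖coeff n B‖) (θ : ℝ) :
    sinSeries (fun n => coeff n (A * B)) θ =
      cosSeries (fun n => coeff n A) θ * sinSeries (fun n => coeff n B) θ +
      sinSeries (fun n => coeff n A) θ * cosSeries (fun n => coeff n B) θ := by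
  have hAc := summable_norm_cos_smul hA θ
  have hAs := summable_norm_sin_smul hA θ
  have hBc := summable_norm_cos_smul hB θ
  have hBs := summable_norm_sin_smul hB θ
  simp only [cosSeries, sinSeries]
  rw [tsum_mul_tsum_eq_tsum_sum_antidiagonal_of_summable_norm hAc hBs,
    tsum_mul_tsum_eq_tsum_sum_antidiagonal_of_summable_norm hAs hBc,
    ← (summable_norm_sum_mul_antidiagonal_of_summable_norm hAc hBs).of_norm.tsum_add
      (summable_norm_sum_mul_antidiagonal_of_summable_norm hAs hBc).of_norm]
  refine tsum_congr fun n => ?_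
  rw [coeff_mul, smul_sum, ← sum_add_distrib]
  refine sum_congr rfl fun p hp => ?_
  rw [← mem_antidiagonal.1 hp, Nat.cast_add, add_mul, Real.sin_add, smul_mul_smul_comm,
    smul_mul_smul_comm, ← add_smul, add_comm]

end CauchyProduct

end TrigonometricSeries

section Contraction

theorem norm_im_le (q : ℍ) : ‖q.im‖ ≤ ‖q‖ := by
  rw [← sq_le_sq₀ (norm_nonneg _) (norm_nonneg _), sq, sq, ← Quaternion.normSq_eq_norm_mul_self,
    ← Quaternion.normSq_eq_norm_mul_self, Quaternion.normSq_def', Quaternion.normSq_def']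
  simp [sq_nonneg]

theorem norm_im_mul_comm (p q : ℍ) : ‖(p * q).im‖ = ‖(q * p).im‖ := by
  rw [← sq_eq_sq₀ (norm_nonneg _) (norm_nonneg _), sq, sq, ← Quaternion.normSq_eq_norm_mul_self,
    ← Quaternion.normSq_eq_norm_mul_self, Quaternion.normSq_def', Quaternion.normSq_def']
  simp only [Quaternion.re_im, Quaternion.imI_im, Quaternion.imJ_im, Quaternion.imK_im,
    Quaternion.imI_mul, Quaternion.imJ_mul, Quaternion.imK_mul]
  ring

theorem exists_norm_add_imaginaryUnit_mul_sq (P Q : ℍ) :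
    ∃ I ∈ imaginaryUnits,
      ‖P + I * Q‖ ^ 2 = ‖P‖ ^ 2 + ‖Q‖ ^ 2 + 2 * ‖(P * star Q).im‖ := by
  obtain ⟨I, hI, hW⟩ := exists_mem_imaginaryUnits_norm_smul_eq (w := (P * star Q).im) (by simp)
  obtain ⟨hre, hnorm⟩ := mem_imaginaryUnits_iff.1 hI
  have hinner : inner ℝ P (I * Q) = ‖(P * star Q).im‖ := by
    calc inner ℝ P (I * Q) = inner ℝ (P * star Q).im I := by
          simp only [Quaternion.inner_def, star_mul, Quaternion.re_mul, Quaternion.re_star, hre,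
            mul_zero, Quaternion.imI_star, mul_neg, neg_mul, neg_neg, zero_sub,
            Quaternion.imJ_star, Quaternion.imK_star, Quaternion.imI_mul, add_zero,
            Quaternion.imJ_mul, Quaternion.imK_mul, Quaternion.re_im, Quaternion.imI_im,
            sub_neg_eq_add, zero_add, Quaternion.imJ_im, Quaternion.imK_im]
          ring
      _ = ‖(P * star Q).im‖ := by
          nth_rw 1 [← hW]
          rw [real_inner_smul_left, real_inner_self_eq_norm_sq, hnorm, one_pow, mul_one]
  refine ⟨I, hI, ?_⟩
  rw [norm_add_sq_real, hinner, norm_mul, hnorm, one_mul]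
  ring

theorem norm_sq_complexified_mul (P Q α β : ℍ) :
    ‖P * α - Q * β‖ ^ 2 + ‖P * β + Q * α‖ ^ 2 =
      (‖P‖ ^ 2 + ‖Q‖ ^ 2) * (‖α‖ ^ 2 + ‖β‖ ^ 2)
        - 4 * inner ℝ (star Q * P).im (β * star α).im := by
  have hcross : inner ℝ (P * α) (Q * β) - inner ℝ (P * β) (Q * α) =
      2 * inner ℝ (star Q * P).im (β * star α).im := by
    simp only [Quaternion.inner_def, star_mul, Quaternion.re_mul, Quaternion.re_star,
      Quaternion.imI_star, mul_neg, neg_mul, neg_neg, Quaternion.imJ_star, Quaternion.imK_star,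
      Quaternion.imI_mul, Quaternion.imJ_mul, Quaternion.imK_mul, Quaternion.star_im,
      Quaternion.re_neg, Quaternion.re_im, mul_zero, Quaternion.imI_im, sub_neg_eq_add, zero_sub,
      Quaternion.imJ_im, Quaternion.imK_im, neg_sub]
    ring
  rw [norm_sub_sq_real, norm_add_sq_real]
  simp only [norm_mul]
  linear_combination -2 * hcross

/-- This says that left multiplication by `P + iQ` is a contraction of the complexification of `ℍ`.
The norm of `P + IQ` is maximal when `I` points in the direction of the imaginary part of
`P * star Q`. -/
theorem norm_sq_complexified_mul_le {P Q : ℍ} (h : ∀ I ∈ imaginaryUnits, ‖P + I * Q‖ ≤ 1)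
    (α β : ℍ) :
    ‖P * α - Q * β‖ ^ 2 + ‖P * β + Q * α‖ ^ 2 ≤ ‖α‖ ^ 2 + ‖β‖ ^ 2 := by
  set w := ‖(P * star Q).im‖
  have hPQ : ‖P‖ ^ 2 + ‖Q‖ ^ 2 + 2 * w ≤ 1 := by
    obtain ⟨I, hI, hIw⟩ := exists_norm_add_imaginaryUnit_mul_sq P Q
    exact hIw ▸ pow_le_one₀ (norm_nonneg _) (h I hI)
  have hinner : -(w * (‖β‖ * ‖α‖)) ≤ inner ℝ (star Q * P).im (β * star α).im := by
    refine neg_le_of_abs_le ((abs_real_inner_le_norm _ _).trans ?_)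
    rw [norm_im_mul_comm]
    gcongr
    simpa only [norm_mul, norm_star] using norm_im_le (β * star α)
  calc ‖P * α - Q * β‖ ^ 2 + ‖P * β + Q * α‖ ^ 2
      ≤ (‖P‖ ^ 2 + ‖Q‖ ^ 2) * (‖α‖ ^ 2 + ‖β‖ ^ 2) + 4 * (w * (‖β‖ * ‖α‖)) := by
        rw [norm_sq_complexified_mul]
        linarith
    _ ≤ (‖P‖ ^ 2 + ‖Q‖ ^ 2 + 2 * w) * (‖α‖ ^ 2 + ‖β‖ ^ 2) := by
        have : 0 ≤ w * (‖α‖ - ‖β‖) ^ 2 := by positivity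
        linarith
    _ ≤ ‖α‖ ^ 2 + ‖β‖ ^ 2 := mul_le_of_le_one_left (by positivity) hPQ

theorem tsum_norm_sq_coeff_mul_le {A B : ℍ⟦X⟧} (hA : Summable fun n => ‖coeff n A‖)
    (hB : Summable fun n => ‖coeff n B‖)
    (h : ∀ θ : ℝ, ∀ I ∈ imaginaryUnits,
      ‖cosSeries (fun n => coeff n A) θ + I * sinSeries (fun n => coeff n A) θ‖ ≤ 1) :
    ∑' n, ‖coeff n (A * B)‖ ^ 2 ≤ ∑' n, ‖coeff n B‖ ^ 2 := by
  have hAB := summable_norm_coeff_mul hA hB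
  refine le_of_mul_le_mul_left ?_ Real.two_pi_pos
  rw [← integral_norm_sq_cosSeries_add_norm_sq_sinSeries hAB,
    ← integral_norm_sq_cosSeries_add_norm_sq_sinSeries hB]
  refine intervalIntegral.integral_mono_on Real.two_pi_pos.le
    ((continuous_norm_sq_cosSeries_add_norm_sq_sinSeries hAB).intervalIntegrable _ _)
    ((continuous_norm_sq_cosSeries_add_norm_sq_sinSeries hB).intervalIntegrable _ _) fun θ _ => ?_
  rw [cosSeries_coeff_mul hA hB, sinSeries_coeff_mul hA hB]
  exact norm_sq_complexified_mul_le (h θ) _ _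

/-- The power series of `q ↦ f (r q)`, if `A` is that of `f`. The variable `r` is real so that it
commutes with the coefficients. -/
noncomputable def dilate {R : Type*} [Semiring R] [Module ℝ R] (r : ℝ) (A : R⟦X⟧) : R⟦X⟧ :=
  PowerSeries.mk fun n => r ^ n • coeff n A

theorem HasExpansion.summable_norm_coeff_dilate {f : ℍ → ℍ} {A : ℍ⟦X⟧} (hA : HasExpansion f A)
    {r : ℝ} (hr : |r| < 1) : Summable fun n => ‖coeff n (dilate r A)‖ := by
  have h := hA r (by simpa [unitBall] using hr)
  simp only [← Quaternion.coe_pow, Quaternion.coe_mul_eq_smul] at h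
  simpa only [dilate, coeff_mk] using summable_norm_iff.2 h.summable

theorem sliceMap_polar_pow {I : ℍ} (hI : I ∈ imaginaryUnits) (r θ : ℝ) (n : ℕ) :
    sliceMap I (r * Complex.exp (θ * Complex.I)) ^ n =
      r ^ n • ((Real.cos (n * θ) : ℍ) + I * (Real.sin (n * θ) : ℍ)) := by
  have h : ((r : ℂ) * Complex.exp (θ * Complex.I)) ^ n =
      (r ^ n : ℝ) • Complex.exp ((n * θ : ℝ) * Complex.I) := by
    rw [mul_pow, ← Complex.exp_nat_mul, Complex.real_smul]
    push_cast
    ring_nf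
  rw [← sliceMap_pow hI, h, ← sliceHom_apply hI, map_smul, sliceHom_apply, sliceMap,
    Complex.exp_ofReal_mul_I_re, Complex.exp_ofReal_mul_I_im]

theorem sliceMap_polar_mem_unitBall {I : ℍ} (hI : I ∈ imaginaryUnits) {r : ℝ} (hr : |r| < 1)
    (θ : ℝ) : sliceMap I (r * Complex.exp (θ * Complex.I)) ∈ unitBall := by
  rw [sliceMap_mem_unitBall hI, norm_mul, Complex.norm_exp_ofReal_mul_I, mul_one]
  simpa using hr

theorem HasExpansion.apply_sliceMap_polar {f : ℍ → ℍ} {A : ℍ⟦X⟧} (hA : HasExpansion f A)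
    {I : ℍ} (hI : I ∈ imaginaryUnits) {r : ℝ} (hr : |r| < 1) (θ : ℝ) :
    f (sliceMap I (r * Complex.exp (θ * Complex.I))) =
      cosSeries (fun n => coeff n (dilate r A)) θ +
        I * sinSeries (fun n => coeff n (dilate r A)) θ := by
  have hsum := hA.summable_norm_coeff_dilate hr
  refine (hA _ (sliceMap_polar_mem_unitBall hI hr θ)).unique (((hasSum_cosSeries hsum θ).add
    ((hasSum_sinSeries hsum θ).mul_left I)).congr_fun fun n => ?_)
  rw [sliceMap_polar_pow hI, dilate, coeff_mk, smul_mul_assoc, add_mul, mul_assoc,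
    Quaternion.coe_mul_eq_smul, Quaternion.coe_mul_eq_smul, smul_add, smul_comm (r ^ n),
    mul_smul_comm, mul_smul_comm, mul_smul_comm, smul_comm (r ^ n)]

theorem HasExpansion.tsum_norm_sq_coeff_dilate_mul_le {f : ℍ → ℍ} {A B : ℍ⟦X⟧}
    (hA : HasExpansion f A) (hf : ∀ q ∈ unitBall, ‖f q‖ ≤ 1)
    (hB : Summable fun n => ‖coeff n B‖) {r : ℝ} (hr : |r| < 1) :
    ∑' n, ‖coeff n (dilate r A * B)‖ ^ 2 ≤ ∑' n, ‖coeff n B‖ ^ 2 := by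
  refine tsum_norm_sq_coeff_mul_le (hA.summable_norm_coeff_dilate hr) hB fun θ I hI => ?_
  rw [← hA.apply_sliceMap_polar hI hr]
  exact hf _ (sliceMap_polar_mem_unitBall hI hr θ)

theorem tendsto_coeff_dilate_mul {R : Type*} [NormedRing R] [NormedAlgebra ℝ R] (A B : R⟦X⟧)
    (n : ℕ) : Tendsto (fun r => coeff n (dilate r A * B)) (𝓝[<] 1) (𝓝 (coeff n (A * B))) := by
  have hcont : Continuous fun r : ℝ => coeff n (dilate r A * B) := by
    simp only [coeff_mul, dilate, coeff_mk]
    fun_prop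
  have hone : dilate 1 A = A := by
    ext
    simp [dilate]
  simpa only [hone] using (hcont.tendsto 1).mono_left nhdsWithin_le_nhds

/-- Regular multiplication by `f` is a contraction of the Hardy space of square summable
coefficients. -/
theorem HasExpansion.sum_norm_sq_coeff_mul_le {f : ℍ → ℍ} {A B : ℍ⟦X⟧} (hA : HasExpansion f A)
    (hf : ∀ q ∈ unitBall, ‖f q‖ ≤ 1) (hB : Summable fun n => ‖coeff n B‖) (N : ℕ) :
    ∑ n ∈ range N, ‖coeff n (A * B)‖ ^ 2 ≤ ∑' n, ‖coeff n B‖ ^ 2 := by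
  have hlim : Tendsto (fun r : ℝ => ∑ n ∈ range N, ‖coeff n (dilate r A * B)‖ ^ 2)
      (𝓝[<] 1) (𝓝 (∑ n ∈ range N, ‖coeff n (A * B)‖ ^ 2)) :=
    tendsto_finsetSum _ fun n _ => (tendsto_coeff_dilate_mul A B n).norm.pow 2
  refine le_of_tendsto hlim ?_
  filter_upwards [Ioo_mem_nhdsLT (zero_lt_one' ℝ)] with r hr
  have hr1 : |r| < 1 := by rw [abs_of_pos hr.1]; exact hr.2
  have hsum : Summable fun n => ‖coeff n (dilate r A * B)‖ ^ 2 :=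
    summable_sq_norm (summable_norm_coeff_mul (hA.summable_norm_coeff_dilate hr1) hB)
  calc ∑ n ∈ range N, ‖coeff n (dilate r A * B)‖ ^ 2
      ≤ ∑' n, ‖coeff n (dilate r A * B)‖ ^ 2 :=
        hsum.sum_le_tsum (range N) fun _ _ => sq_nonneg _
    _ ≤ ∑' n, ‖coeff n B‖ ^ 2 := hA.tsum_norm_sq_coeff_dilate_mul_le hf hB hr1

end Contraction

section FixedPoints

theorem hasSum_sum_antidiagonal {E : Type*} [AddCommMonoid E] [TopologicalSpace E]
    [ContinuousAdd E] [RegularSpace E] {g : ℕ × ℕ → E} {s : E}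
    (hg : HasSum g s) : HasSum (fun n => ∑ x ∈ antidiagonal n, g x) s := by
  have h : HasSum (fun x : Σ n : ℕ, antidiagonal n => g x.2) s :=
    HasAntidiagonal.sigmaAntidiagonalEquivProd.hasSum_iff.2 hg
  exact h.sigma fun n => (antidiagonal n).hasSum g

theorem hasSum_pow_mul_coeff_mul {R : Type*} [NormedRing R] [NormOneClass R] [CompleteSpace R]
    {A B : R⟦X⟧} {p s : R} (hp : ‖p‖ ≤ 1) (hA : Summable fun n => ‖p ^ n * coeff n A‖)
    (hs : HasSum (fun n => p ^ n * coeff n A) s) (hB : Summable fun n => ‖coeff n B‖) :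
    HasSum (fun n => p ^ n * coeff n (A * B)) (∑' m, p ^ m * s * coeff m B) := by
  set g : ℕ × ℕ → R := fun x => p ^ x.2 * (p ^ x.1 * coeff x.1 A) * coeff x.2 B with hg
  have hgsum : Summable g := by
    refine .of_norm_bounded
      (hA.mul_of_nonneg hB (fun _ => norm_nonneg _) fun _ => norm_nonneg _) fun x => ?_
    have hpow : ‖p ^ x.2‖ ≤ 1 := (norm_pow_le p _).trans (pow_le_one₀ (norm_nonneg _) hp)
    refine (norm_mul_le _ _).trans (mul_le_mul_of_nonneg_right ?_ (norm_nonneg _))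
    exact (norm_mul_le _ _).trans (mul_le_of_le_one_left (norm_nonneg _) hpow)
  have hrows : HasSum (fun m => p ^ m * s * coeff m B) (∑' x, g x) :=
    ((Equiv.prodComm ℕ ℕ).hasSum_iff.2 hgsum.hasSum).prod_fiberwise fun m =>
      (hs.mul_left (p ^ m)).mul_right (coeff m B)
  rw [hrows.tsum_eq]
  refine (hasSum_sum_antidiagonal hgsum.hasSum).congr_fun fun n => ?_
  rw [coeff_mul, mul_sum]
  refine sum_congr rfl fun x hx => ?_
  rw [hg, ← mem_antidiagonal.1 hx, add_comm, pow_add]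
  simp only [mul_assoc]

theorem HasExpansion.hasSum_pow_mul_coeff_mul {f : ℍ → ℍ} {A B : ℍ⟦X⟧} (hA : HasExpansion f A)
    (hB : Summable fun n => ‖coeff n B‖) {p : ℍ} (hp : p ∈ unitBall) :
    HasSum (fun n => p ^ n * coeff n (A * B)) (∑' m, p ^ m * f p * coeff m B) :=
  SliceRegular.hasSum_pow_mul_coeff_mul (le_of_lt hp) (summable_norm_iff.2 (hA p hp).summable)
    (hA p hp) hB

theorem eq_of_tsum_norm_sq_le_of_hasSum_inner {E ι : Type*} [NormedAddCommGroup E]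
    [InnerProductSpace ℝ E] {c h : ι → E} {s : ℝ} (hh : HasSum (fun i => ‖h i‖ ^ 2) s)
    (hc : Summable fun i => ‖c i‖ ^ 2) (hcs : ∑' i, ‖c i‖ ^ 2 ≤ s)
    (hinner : HasSum (fun i => inner ℝ (h i) (c i)) s) : c = h := by
  have hdist : HasSum (fun i => ‖h i - c i‖ ^ 2) (s - 2 * s + ∑' i, ‖c i‖ ^ 2) := by
    simpa only [norm_sub_sq_real] using (hh.sub (hinner.mul_left 2)).add hc.hasSum
  have hzero : s - 2 * s + ∑' i, ‖c i‖ ^ 2 = 0 :=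
    le_antisymm (by linarith) (hdist.nonneg fun _ => sq_nonneg _)
  rw [hzero, hasSum_zero_iff_of_nonneg fun _ => sq_nonneg _] at hdist
  funext i
  exact (sub_eq_zero.1 (norm_eq_zero.1 (sq_eq_zero_iff.1 (congrFun hdist i)))).symm

/-- The difference of the reproducing kernels of the Hardy space at `p` and `q`: the inner product
with it is the real part of the difference of the values at `p` and `q`. -/
noncomputable def kernelDiff (p q : ℍ) : ℍ⟦X⟧ := PowerSeries.mk fun n => star (p ^ n - q ^ n)

theorem hasSum_inner_kernelDiff {p q s t : ℍ} {C : ℍ⟦X⟧}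
    (hp : HasSum (fun n => p ^ n * coeff n C) s) (hq : HasSum (fun n => q ^ n * coeff n C) t) :
    HasSum (fun n => inner ℝ (coeff n (kernelDiff p q)) (coeff n C)) (inner ℝ 1 (s - t)) := by
  refine ((innerSL ℝ (1 : ℍ)).hasSum (hp.sub hq)).congr_fun fun n => ?_
  simp only [kernelDiff, coeff_mk, innerSL_apply_apply, ← sub_mul,
    Quaternion.inner_def, star_mul, one_mul, star_sub, star_pow, Quaternion.re_mul,
    Quaternion.re_sub, Quaternion.re_star, Quaternion.imI_sub, Quaternion.imI_star, mul_neg,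
    sub_neg_eq_add, Quaternion.imJ_sub, Quaternion.imJ_star, Quaternion.imK_sub,
    Quaternion.imK_star, neg_mul]
  ring

theorem summable_norm_coeff_kernelDiff {p q : ℍ} (hp : p ∈ unitBall) (hq : q ∈ unitBall) :
    Summable fun n => ‖coeff n (kernelDiff p q)‖ := by
  refine ((summable_geometric_of_lt_one (norm_nonneg p) hp).add
    (summable_geometric_of_lt_one (norm_nonneg q) hq)).of_nonneg_of_le
    (fun _ => norm_nonneg _) fun n => ?_
  rw [kernelDiff, coeff_mk, norm_star, ← norm_pow, ← norm_pow]
  exact norm_sub_le _ _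

theorem kernelDiff_ne_zero {p q : ℍ} (hpq : p ≠ q) : kernelDiff p q ≠ 0 := fun h => by
  have h1 : star (p ^ 1 - q ^ 1) = 0 := by simpa [kernelDiff] using congrArg (coeff 1) h
  exact hpq (by simpa [sub_eq_zero] using h1)

theorem X_mul_shift_kernelDiff (p q : ℍ) :
    X * PowerSeries.mk (fun n => coeff (n + 1) (kernelDiff p q)) = kernelDiff p q := by
  conv_rhs => rw [eq_X_mul_shift_add_const (kernelDiff p q)]
  simp [kernelDiff]

theorem HasExpansion.eq_X_of_fixed_points {f : ℍ → ℍ} {A : ℍ⟦X⟧} (hA : HasExpansion f A)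
    (hf : ∀ q ∈ unitBall, ‖f q‖ ≤ 1) {p q : ℍ} (hp : p ∈ unitBall) (hq : q ∈ unitBall)
    (hpq : p ≠ q) (hfp : f p = p) (hfq : f q = q) : A = X := by
  set H := kernelDiff p q
  set U : ℍ⟦X⟧ := PowerSeries.mk fun n => coeff (n + 1) H
  have hXU : X * U = H := X_mul_shift_kernelDiff p q
  have hH : Summable fun n => ‖coeff n H‖ := summable_norm_coeff_kernelDiff hp hq
  have hU : Summable fun n => ‖coeff n U‖ := by
    simpa only [U, coeff_mk] using (summable_nat_add_iff 1).2 hH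
  have hnorm : HasSum (fun n => ‖coeff n H‖ ^ 2) (∑' n, ‖coeff n U‖ ^ 2) := by
    refine (hasSum_nat_add_iff' 1).1 ?_
    simpa [H, U, kernelDiff] using (summable_sq_norm hU).hasSum
  have hinner : HasSum (fun n => inner ℝ (coeff n H) (coeff n (A * U)))
      (∑' n, ‖coeff n U‖ ^ 2) := by
    have hAU := hasSum_inner_kernelDiff (hA.hasSum_pow_mul_coeff_mul hU hp)
      (hA.hasSum_pow_mul_coeff_mul hU hq)
    have hHH := hasSum_inner_kernelDiff (hasExpansion_X.hasSum_pow_mul_coeff_mul hU hp)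
      (hasExpansion_X.hasSum_pow_mul_coeff_mul hU hq)
    simp only [hXU, H, real_inner_self_eq_norm_sq, id_eq] at hHH
    rw [hfp, hfq] at hAU
    exact hnorm.unique hHH ▸ hAU
  have hbound := hA.sum_norm_sq_coeff_mul_le hf hU
  have hAU : A * U = X * U := by
    have := eq_of_tsum_norm_sq_le_of_hasSum_inner hnorm
      (summable_of_sum_range_le (fun _ => sq_nonneg _) hbound)
      (Real.tsum_le_of_sum_range_le (fun _ => sq_nonneg _) hbound) hinner
    rw [hXU]
    exact PowerSeries.ext (congrFun this)
  have hU0 : U ≠ 0 := right_ne_zero_of_mul (hXU.trans_ne (kernelDiff_ne_zero hpq))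
  exact mul_right_cancel₀ hU0 hAU

end FixedPoints

end SliceRegular

theorem mainTheorem3 (f : Quaternion ℝ → Quaternion ℝ)
    (hf : SliceRegular.IsSliceRegularOn f SliceRegular.unitBall)
    (hmaps : Set.MapsTo f SliceRegular.unitBall SliceRegular.unitBall)
    (q₀ : Quaternion ℝ) (hq₀ : q₀ ∈ SliceRegular.unitBall) (hfix : f q₀ = q₀) :
    (∀ q ∈ SliceRegular.unitBall, f q = q) ∨
      (∀ q ∈ SliceRegular.unitBall, f q = q → q = q₀) := by
  obtain ⟨A, hA⟩ := hf.exists_hasExpansion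
  by_cases hunique : ∀ q ∈ SliceRegular.unitBall, f q = q → q = q₀
  · exact .inr hunique
  · push Not at hunique
    obtain ⟨p, hp, hfp, hne⟩ := hunique
    obtain rfl := hA.eq_X_of_fixed_points (fun q hq => (hmaps hq).le) hp hq₀ hne hfp hfix
    exact .inl fun q hq => (hA q hq).unique (SliceRegular.hasExpansion_X q hq)
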